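/- Let $\mathbb N=\{1,2,\dots\}$. A non-autonomous system $(X,f_{1,\infty})$ is a compact metric space $(X,d)$ with a sequence $f_{1,\infty}=(f_n)_{n\ge1}$ of continuous maps $f_n:X\to X$. Put $f_i^n=f_{i+n-1}\circ\cdots\circ f_i$ and $D(g,h)=\sup_{x}d(g(x),h(x))$. The system is * *transitive* if for all nonempty open $U,V\subseteq X$ there is $n\in\mathbb N$ with $f_1^n(U)\cap V\ne\emptyset$; * *mixing* if for all nonempty open $U,V\subseteq X$ there is $N\in\mathbb N$ with $f_1^n(U)\cap V\neq\emptyset$ for all $n\ge N$; * *mildly mixing* if for every transitive non-autonomous system $(Y,g_{1,\infty})$ the product $(X\times Y,(f_n\times g_n)_n)$ is transitive, and *mildly mixing with respect to spaces without isolated points* if this is required only for $Y$ without isolated points (a weaker property); * *feebly open* if $\operatorname{int} f_i(U)\ne\emptyset$ for all $i$ and all nonempty open $U\subseteq X$; *surjective* if every $f_i$ is surjective. An autonomous system $(X,f)$ is transitive, mixing or feebly open if the constant sequence $(f,f,\dots)$ is; it is *mildly mixing* if for every transitive *autonomous* system $(Y,g)$ (with $Y$ compact metric, $g$ continuous) the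 map $f\times g$ is transitive. The sequence $f_{1,\infty}$ *converges collectively* to $f$ if for every $\varepsilon>0$ there is $r_0$ with $D(f_r^k,f^k)<\varepsilon$ for all $r\ge r_0$ and all $k\in\mathbb N$. **Theorem.** 1. Let $(X,f_{1,\infty})$ be a feebly open and surjective non-autonomous system that converges uniformly and collectively to a continuous map $f:X\to X$. If $(X,f_{1,\infty})$ is mildly mixing, then $(X,f)$ is mildly mixing. It suffices that $(X,f_{1,\infty})$ is mildly mixing with respect to spaces without isolated points. 2. The converse fails in general. If $(X,f)$ is a mildly mixing autonomous system that is not mixing, then the constant sequence $f_{1,\infty}=(f,f,\dots)$ is surjective and converges uniformly and collectively to $f$, but it is not mildly mixing, not even with respect to spaces without isolated points. Mildly mixing, non-mixing autonomous systems $(X,f)$ exist, and $f$ can moreover be chosen feebly open, so that all hypotheses of part 1 hold for the constant sequence $(f,f,\dots)$. -/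

import Mathlib

open Filter Topology

universe u v w

namespace NDS

/-- A non-autonomous discrete system on `X` is a sequence `F : ℕ → C(X, X)`; the `n`-th map
`f_n` (`n = 1, 2, …`) of the usual notation `f_{1,∞} = (f_1, f_2, …)` is `F (n - 1)`.
`evol F i n` is the composition of the `n` consecutive maps `F i, F (i + 1), …, F (i + n - 1)`
(`F i` is applied first); in particular `evol F 0 n` is `f_1^n`. -/
def evol {X : Type u} [TopologicalSpace X] (F : ℕ → C(X, X)) (i : ℕ) : ℕ → C(X, X)
  | 0 => ContinuousMap.id X
  | n + 1 => (F (i + n)).comp (evol F i n)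

/-- The constant sequence `(f, f, f, …)`, that is, the autonomous system `(X, f)`. -/
def const {X : Type u} [TopologicalSpace X] (f : C(X, X)) : ℕ → C(X, X) := fun _ => f

/-- For a constant sequence, `evol` is ordinary iteration. -/
theorem coe_evol_const {X : Type u} [TopologicalSpace X] (f : C(X, X)) (i n : ℕ) :
    ⇑(evol (const f) i n) = f^[n] := by
  induction n with
  | zero => rfl
  | succ n ih => rw [Function.iterate_succ', ← ih]; rfl

/-- The product system on `X × Y`. -/
def prod {X : Type u} {Y : Type v} [TopologicalSpace X] [TopologicalSpace Y]
    (F : ℕ → C(X, X)) (G : ℕ → C(Y, Y)) : ℕ → C(X × Y, X × Y) :=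
  fun n => (F n).prodMap (G n)

/-- Topological transitivity: for all nonempty open `U, V` there is `n ≥ 1` with
`f_1^n(U) ∩ V ≠ ∅`. -/
def IsTransitive {X : Type u} [TopologicalSpace X] (F : ℕ → C(X, X)) : Prop :=
  ∀ U V : Set X, IsOpen U → U.Nonempty → IsOpen V → V.Nonempty →
    ∃ n : ℕ, 1 ≤ n ∧ (evol F 0 n '' U ∩ V).Nonempty

/-- Topological mixing: for all nonempty open `U, V` there is `N ≥ 1` with
`f_1^n(U) ∩ V ≠ ∅` for every `n ≥ N`. -/
def IsMixing {X : Type u} [TopologicalSpace X] (F : ℕ → C(X, X)) : Prop :=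
  ∀ U V : Set X, IsOpen U → U.Nonempty → IsOpen V → V.Nonempty →
    ∃ N : ℕ, 1 ≤ N ∧ ∀ n : ℕ, N ≤ n → (evol F 0 n '' U ∩ V).Nonempty

/-- Mild mixing of a non-autonomous system: the product with every transitive
non-autonomous system on a compact metric space is transitive. -/
def IsMildlyMixing {X : Type u} [TopologicalSpace X] (F : ℕ → C(X, X)) : Prop :=
  ∀ (Y : Type v) [MetricSpace Y] [CompactSpace Y] (G : ℕ → C(Y, Y)),
    IsTransitive G → IsTransitive (prod F G)

/-- The (weaker) variant of mild mixing of a non-autonomous system in which only transitive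
non-autonomous systems on compact metric spaces without isolated points are tested. -/
def IsMildlyMixingPerfect {X : Type u} [TopologicalSpace X] (F : ℕ → C(X, X)) : Prop :=
  ∀ (Y : Type v) [MetricSpace Y] [CompactSpace Y] [PerfectSpace Y] (G : ℕ → C(Y, Y)),
    IsTransitive G → IsTransitive (prod F G)

/-- Mild mixing of an autonomous system `(X, f)`: the product with every transitive
autonomous system on a compact metric space is transitive. -/
def IsMildlyMixingAut {X : Type u} [TopologicalSpace X] (f : C(X, X)) : Prop :=
  ∀ (Y : Type v) [MetricSpace Y] [CompactSpace Y] (g : C(Y, Y)),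
    IsTransitive (const g) → IsTransitive (prod (const f) (const g))

/-- Feeble openness: every map of the sequence sends nonempty open sets to sets with
nonempty interior. -/
def IsFeeblyOpen {X : Type u} [TopologicalSpace X] (F : ℕ → C(X, X)) : Prop :=
  ∀ (i : ℕ) (U : Set X), IsOpen U → U.Nonempty → (interior (F i '' U)).Nonempty

/-- Every map of the sequence is surjective. -/
def IsSurjective {X : Type u} [TopologicalSpace X] (F : ℕ → C(X, X)) : Prop :=
  ∀ i : ℕ, Function.Surjective (F i)

/-- Uniform convergence of the sequence to `f`. -/
def ConvergesUniformly {X : Type u} [MetricSpace X] (F : ℕ → C(X, X)) (f : C(X, X)) : Prop :=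
  TendstoUniformly (fun n x => F n x) f atTop

/-- Collective convergence: for every `ε > 0` there is `r₀` such that `D(f_r^k, f^k) < ε` for
all `r ≥ r₀` and all `k ≥ 1`. The distance `D` on `C(X, X)`, `X` compact, is the supremum
metric, which is Mathlib's `dist` on `C(X, X)`. -/
def ConvergesCollectively {X : Type u} [MetricSpace X] [CompactSpace X]
    (F : ℕ → C(X, X)) (f : C(X, X)) : Prop :=
  ∀ ε : ℝ, 0 < ε → ∃ r₀ : ℕ, ∀ r : ℕ, r₀ ≤ r → ∀ k : ℕ, 1 ≤ k →
    dist (evol F r k) (evol (const f) 0 k) < ε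

end NDS

/-! Limit map: given a transitive `g`, let the test system stand still for `r` steps and only then
iterate `g`. Pull `U` back through the first `r` maps of `F`, which is possible by surjectivity. A
hitting time `r + k` with `k ≥ 1` then gives a point of `U` whose image under the tail of `F` lies
near the target, and collective convergence replaces the tail by `f^k`. A doubling-map factor
removes isolated points from the test space, so hitting times beyond `r` exist
(`IsMildlyMixingPerfect.of_convergesCollectively`). Converse: if `f` is not mixing, `U` misses `V`
at infinitely many times. Circle translations that are the identity at all other times and have a
dense orbit form a transitive system whose product with `f` is not transitive
(`not_isMildlyMixingPerfect_const`). Example: in the spacing shift only times near powers of two are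
forbidden. These are so sparse that recurrence of `g` avoids them (`far_from_pow_two`), but they are
infinitely many. -/

namespace NDS

/-! ### Evolutions, products and large hitting times -/

section General

variable {X : Type u} {Y : Type v} [TopologicalSpace X] [TopologicalSpace Y]

theorem isTransitive_iff {F : ℕ → C(X, X)} :
    IsTransitive F ↔ ∀ U V : Set X, IsOpen U → U.Nonempty → IsOpen V → V.Nonempty →
      ∃ n, 1 ≤ n ∧ ∃ x ∈ U, evol F 0 n x ∈ V := by
  simp only [IsTransitive, Set.image_inter_nonempty_iff]
  rfl

theorem evol_prod (F : ℕ → C(X, X)) (G : ℕ → C(Y, Y)) (i n : ℕ) (p : X × Y) :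
    evol (prod F G) i n p = (evol F i n p.1, evol G i n p.2) := by
  induction n with
  | zero => rfl
  | succ n ih =>
    change prod F G (i + n) (evol (prod F G) i n p) = _
    rw [ih]
    rfl

theorem evol_add (F : ℕ → C(X, X)) (i m n : ℕ) (x : X) :
    evol F i (m + n) x = evol F (i + m) n (evol F i m x) := by
  induction n with
  | zero => rfl
  | succ n ih =>
    change F (i + (m + n)) (evol F i (m + n) x) = F (i + m + n) _
    rw [ih, add_assoc]

theorem evol_const_apply (f : C(X, X)) (i n : ℕ) (x : X) : evol (const f) i n x = f^[n] x := by
  rw [coe_evol_const]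

theorem IsSurjective.evol {F : ℕ → C(X, X)} (hF : IsSurjective F) (i n : ℕ) :
    Function.Surjective (evol F i n) := by
  induction n with
  | zero => exact Function.surjective_id
  | succ n ih => exact (hF (i + n)).comp ih

/-- Transitivity of a product can be tested on open rectangles. -/
theorem isTransitive_prod_iff {F : ℕ → C(X, X)} {G : ℕ → C(Y, Y)} :
    IsTransitive (prod F G) ↔ ∀ (U V : Set X) (U' V' : Set Y),
      IsOpen U → U.Nonempty → IsOpen V → V.Nonempty →
      IsOpen U' → U'.Nonempty → IsOpen V' → V'.Nonempty →
      ∃ n, 1 ≤ n ∧ (∃ x ∈ U, evol F 0 n x ∈ V) ∧ ∃ y ∈ U', evol G 0 n y ∈ V' := by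
  rw [isTransitive_iff]
  constructor
  · intro h U V U' V' hU hU0 hV hV0 hU' hU'0 hV' hV'0
    obtain ⟨n, hn, p, hp, hpV⟩ := h (U ×ˢ U') (V ×ˢ V') (hU.prod hU') (hU0.prod hU'0)
      (hV.prod hV') (hV0.prod hV'0)
    rw [evol_prod] at hpV
    exact ⟨n, hn, ⟨p.1, hp.1, hpV.1⟩, p.2, hp.2, hpV.2⟩
  · rintro h W W' hW ⟨⟨a, b⟩, hab⟩ hW' ⟨⟨c, d⟩, hcd⟩
    obtain ⟨U, U', hU, hU', ha, hb, hs⟩ := isOpen_prod_iff.1 hW a b hab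
    obtain ⟨V, V', hV, hV', hc, hd, hs'⟩ := isOpen_prod_iff.1 hW' c d hcd
    obtain ⟨n, hn, ⟨x, hx, hxV⟩, y, hy, hyV⟩ :=
      h U V U' V' hU ⟨a, ha⟩ hV ⟨c, hc⟩ hU' ⟨b, hb⟩ hV' ⟨d, hd⟩
    refine ⟨n, hn, (x, y), hs ⟨hx, hy⟩, ?_⟩
    rw [evol_prod]
    exact hs' ⟨hxV, hyV⟩

/-- In a transitive system on a Hausdorff space without isolated points, hitting times can be
taken arbitrarily large. -/
theorem IsTransitive.exists_gt_of_perfectSpace [T2Space X] [PerfectSpace X] {F : ℕ → C(X, X)}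
    (hF : IsTransitive F) (r : ℕ) {U V : Set X} (hU : IsOpen U) (hU0 : U.Nonempty)
    (hV : IsOpen V) (hV0 : V.Nonempty) : ∃ n, r < n ∧ ∃ x ∈ U, evol F 0 n x ∈ V := by
  obtain ⟨u, hu⟩ := hU0
  obtain ⟨v, hv⟩ := hV0
  let S : Finset X := by
    classical exact (Finset.range (r + 1)).image fun i => evol F 0 i u
  have hS : ∀ i ≤ r, evol F 0 i u ∈ S := fun i hi => by
    classical exact Finset.mem_image_of_mem _ (Finset.mem_range.2 (by omega))
  obtain ⟨w, hwV, hwS⟩ : ∃ w ∈ V, w ∉ S :=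
    (infinite_of_mem_nhds v (hV.mem_nhds hv)).exists_notMem_finset S
  obtain ⟨O, O', hO, hO', hSO, hwO, hd⟩ := SeparatedNhds.of_isCompact_isCompact
    S.finite_toSet.isCompact (isCompact_singleton (x := w))
    (Set.disjoint_singleton_right.2 (by simpa using hwS))
  -- Shrinking `U` keeps times `0, …, r` inside `O`, so a hit in `O'` must come later.
  obtain ⟨n, -, x, hx, hxV⟩ := isTransitive_iff.1 hF
    (U ∩ ⋂ i ∈ Finset.range (r + 1), evol F 0 i ⁻¹' O) (V ∩ O')
    (hU.inter (isOpen_biInter_finset fun i _ => hO.preimage (evol F 0 i).continuous))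
    ⟨u, hu, by
      simp only [Set.mem_iInter, Finset.mem_range]
      exact fun i hi => hSO (hS i (by omega))⟩
    (hV.inter hO') ⟨w, hwV, hwO rfl⟩
  refine ⟨n, ?_, x, hx.1, hxV.1⟩
  by_contra! hn
  have := hx.2
  simp only [Set.mem_iInter, Finset.mem_range] at this
  exact Set.disjoint_left.1 hd (this n (by omega)) hxV.2

/-- In a transitive autonomous system, hitting times can be taken arbitrarily large. -/
theorem IsTransitive.exists_ge_iterate {g : C(Y, Y)} (hg : IsTransitive (const g)) (K : ℕ) :
    ∀ {U V : Set Y}, IsOpen U → U.Nonempty → IsOpen V → V.Nonempty →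
      ∃ n, K ≤ n ∧ ∃ y ∈ U, g^[n] y ∈ V := by
  have key : ∀ U V : Set Y, IsOpen U → U.Nonempty → IsOpen V → V.Nonempty →
      ∃ n, 1 ≤ n ∧ ∃ y ∈ U, g^[n] y ∈ V := by
    simpa only [evol_const_apply] using isTransitive_iff.1 hg
  induction K with
  | zero =>
    intro U V hU hU0 hV hV0
    obtain ⟨n, -, h⟩ := key U V hU hU0 hV hV0
    exact ⟨n, Nat.zero_le n, h⟩
  | succ K ih =>
    intro U V hU hU0 hV hV0
    -- A return time `p ≥ 1` of `V` to itself lengthens any hitting time.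
    obtain ⟨p, hp, z, hz, hzV⟩ := key V V hV hV0 hV hV0
    obtain ⟨n, hn, y, hy, hyV⟩ := ih hU hU0 (hV.inter (hV.preimage (g.continuous.iterate p)))
      ⟨z, hz, hzV⟩
    refine ⟨p + n, by omega, y, hy, ?_⟩
    rw [Function.iterate_add_apply]
    exact hyV.2

/-- A space is perfect if through each point passes an injective continuous image of a perfect
space. -/
theorem perfectSpace_of_injective [PerfectSpace Y]
    (h : ∀ x : X, ∃ (i : Y → X) (y : Y), Continuous i ∧ Function.Injective i ∧ i y = x) :
    PerfectSpace X := by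
  rw [perfectSpace_iff_forall_not_isolated]
  intro x
  obtain ⟨i, y, hi, hinj, rfl⟩ := h x
  by_contra hx
  rw [not_neBot, ← isOpen_singleton_iff_punctured_nhds] at hx
  have hy : IsOpen ({y} : Set Y) := by
    convert hx.preimage hi
    ext z
    simp [hinj.eq_iff]
  rw [isOpen_singleton_iff_punctured_nhds] at hy
  exact (PerfectSpace.not_isolated y).ne hy

theorem perfectSpace_prod_right [PerfectSpace Y] : PerfectSpace (X × Y) :=
  perfectSpace_of_injective fun p => ⟨fun y => (p.1, y), p.2, by fun_prop,
    fun _ _ h => (Prod.mk.inj h).2, rfl⟩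

theorem _root_.Homeomorph.perfectSpace [PerfectSpace Y] (e : X ≃ₜ Y) : PerfectSpace X :=
  perfectSpace_of_injective fun x => ⟨e.symm, e x, e.symm.continuous, e.symm.injective,
    e.symm_apply_apply x⟩

/-- The system obtained from `G` by transport along a homeomorphism. -/
def conj (e : X ≃ₜ Y) (G : ℕ → C(Y, Y)) (n : ℕ) : C(X, X) :=
  ⟨fun x => e.symm (G n (e x)), by fun_prop⟩

theorem evol_conj (e : X ≃ₜ Y) (G : ℕ → C(Y, Y)) (i n : ℕ) (x : X) :
    evol (conj e G) i n x = e.symm (evol G i n (e x)) := by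
  induction n with
  | zero => exact (e.symm_apply_apply x).symm
  | succ n ih =>
    change e.symm (G (i + n) (e (evol (conj e G) i n x))) = _
    rw [ih, e.apply_symm_apply]
    rfl

theorem IsTransitive.conj {G : ℕ → C(Y, Y)} (hG : IsTransitive G) (e : X ≃ₜ Y) :
    IsTransitive (conj e G) := by
  rw [isTransitive_iff] at hG ⊢
  intro U V hU hU0 hV hV0
  obtain ⟨n, hn, y, hy, hyV⟩ := hG (e.symm ⁻¹' U) (e.symm ⁻¹' V)
    (hU.preimage e.symm.continuous) (hU0.preimage e.symm.surjective)
    (hV.preimage e.symm.continuous) (hV0.preimage e.symm.surjective)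
  exact ⟨n, hn, e.symm y, hy, by simpa [evol_conj] using hyV⟩

end General

/-! ### Change of universe for the test spaces -/

/-- Metric spaces with a countable dense subset have at most continuum many points. -/
theorem small_of_separable_metric (Y : Type w) [MetricSpace Y] [TopologicalSpace.SeparableSpace Y] :
    Small.{v} Y := by
  rcases isEmpty_or_nonempty Y with h | h
  · infer_instance
  -- Distances to a dense sequence embed `Y` into `ℕ → ℝ`, which is small in every universe.
  refine small_of_injective (f := fun (y : Y) (n : ℕ) =>
    dist y (TopologicalSpace.denseSeq Y n)) fun y z hyz => ?_
  have hd := (TopologicalSpace.denseRange_denseSeq Y)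
  have : (fun a => dist y a) = fun a => dist z a :=
    hd.equalizer (by fun_prop) (by fun_prop) hyz
  simpa using (congrFun this z)

/-- The universe of the test spaces is irrelevant for mild mixing. -/
theorem IsMildlyMixingPerfect.lift {X : Type u} [TopologicalSpace X] {F : ℕ → C(X, X)}
    (hF : IsMildlyMixingPerfect.{u, v} F) : IsMildlyMixingPerfect.{u, w} F := by
  intro Y _ _ _ G hG
  have : Small.{v} Y := small_of_separable_metric Y
  let e : Shrink.{v} Y ≃ₜ Y := (Shrink.homeomorph Y).symm
  have := e.perfectSpace
  have : CompactSpace (Shrink.{v} Y) := e.symm.compactSpace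
  have : TopologicalSpace.MetrizableSpace (Shrink.{v} Y) := e.isEmbedding.metrizableSpace
  let _ : MetricSpace (Shrink.{v} Y) := TopologicalSpace.metrizableSpaceMetric _
  have h := hF (Shrink.{v} Y) (conj e G) (hG.conj e)
  rw [isTransitive_prod_iff] at h ⊢
  intro U V U' V' hU hU0 hV hV0 hU' hU'0 hV' hV'0
  obtain ⟨n, hn, h1, y, hy, hyV⟩ := h U V (e ⁻¹' U') (e ⁻¹' V') hU hU0 hV hV0
    (hU'.preimage e.continuous) (hU'0.preimage e.surjective)
    (hV'.preimage e.continuous) (hV'0.preimage e.surjective)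
  exact ⟨n, hn, h1, e y, hy, by simpa [evol_conj] using hyV⟩

theorem IsMildlyMixing.perfect {X : Type u} [TopologicalSpace X] {F : ℕ → C(X, X)}
    (hF : IsMildlyMixing.{u, v} F) : IsMildlyMixingPerfect.{u, v} F :=
  fun Y _ _ _ G hG => hF Y G hG

/-! ### Delayed test systems and passage to the limit map -/

instance : Nontrivial UnitAddCircle := by
  refine ⟨⟨((1 / 2 : ℝ) : UnitAddCircle), 0, fun h => ?_⟩⟩
  have := AddCircle.norm_half_period_eq (1 : ℝ)
  rw [h] at this
  norm_num at this

/-- The doubling map of the circle. -/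
def doubling : C(UnitAddCircle, UnitAddCircle) := ⟨fun z => z + z, by fun_prop⟩

theorem doubling_iterate (n : ℕ) (z : UnitAddCircle) : doubling^[n] z = 2 ^ n • z := by
  induction n with
  | zero => simp
  | succ n ih =>
    rw [Function.iterate_succ_apply', ih]
    change 2 ^ n • z + 2 ^ n • z = _
    rw [pow_succ, mul_two, add_smul]

/-- An arc of length `ε` is stretched by `2 ^ n` and covers the circle once `2 ^ n * ε > 1`. -/
theorem doubling_eventually_surjOn {U : Set UnitAddCircle} (hU : IsOpen U) (hU0 : U.Nonempty) :
    ∃ N, ∀ n, N ≤ n → ∀ v, ∃ z ∈ U, doubling^[n] z = v := by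
  obtain ⟨u, hu⟩ := hU0
  obtain ⟨a, -, rfl⟩ := AddCircle.eq_coe_Ico u
  obtain ⟨ε, hε, hball⟩ := Metric.isOpen_iff.1
    (hU.preimage (AddCircle.continuous_mk' (1 : ℝ))) a hu
  obtain ⟨N, hN⟩ := exists_pow_lt_of_lt_one hε (one_half_lt_one (α := ℝ))
  refine ⟨N, fun n hn v => ?_⟩
  obtain ⟨t, ht, htv⟩ := AddCircle.eq_coe_Ico (v - 2 ^ n • (a : UnitAddCircle))
  have hlt : t / 2 ^ n < ε := by
    calc t / 2 ^ n ≤ 1 / 2 ^ n := by gcongr; exact ht.2.le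
      _ = (1 / 2) ^ n := by rw [div_pow, one_pow]
      _ ≤ (1 / 2) ^ N := pow_le_pow_of_le_one (by norm_num) (by norm_num) hn
      _ < ε := hN
  refine ⟨((a + t / 2 ^ n : ℝ) : UnitAddCircle), hball ?_, ?_⟩
  · have : 0 ≤ t / 2 ^ n := div_nonneg ht.1 (by positivity)
    rw [Metric.mem_ball, Real.dist_eq, add_sub_cancel_left, abs_of_nonneg this]
    exact hlt
  · have : 2 ^ n • (a + t / 2 ^ n) = 2 ^ n • a + t := by
      rw [nsmul_eq_mul, nsmul_eq_mul]
      push_cast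
      field_simp
    rw [doubling_iterate, ← AddCircle.coe_nsmul, this, AddCircle.coe_add, htv, AddCircle.coe_nsmul,
      add_sub_cancel]

/-- Wait for `r` steps, then iterate `g`. -/
def delay {X : Type u} [TopologicalSpace X] (r : ℕ) (g : C(X, X)) (n : ℕ) : C(X, X) :=
  if n < r then ContinuousMap.id X else g

theorem evol_delay {X : Type u} [TopologicalSpace X] (r : ℕ) (g : C(X, X)) (n : ℕ) (x : X) :
    evol (delay r g) 0 (r + n) x = g^[n] x := by
  have h : ∀ m ≤ r, evol (delay r g) 0 m x = x := by
    intro m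
    induction m with
    | zero => exact fun _ => rfl
    | succ m ih =>
      intro hm
      change delay r g (0 + m) (evol (delay r g) 0 m x) = x
      rw [ih (by omega), delay, if_pos (by omega)]
      rfl
  induction n with
  | zero => exact h r le_rfl
  | succ n ih =>
    change delay r g (0 + (r + n)) (evol (delay r g) 0 (r + n) x) = _
    rw [ih, delay, if_neg (by omega), Function.iterate_succ_apply']

/-- The doubling factor hits every target at all late times, so any sufficiently late hitting time
of `g` serves both factors. -/
theorem isTransitive_delay_prod_doubling {Y : Type v} [TopologicalSpace Y] {g : C(Y, Y)}
    (hg : IsTransitive (const g)) (r : ℕ) :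
    IsTransitive (prod (delay r g) (delay r doubling)) := by
  rw [isTransitive_prod_iff]
  intro U V U' V' hU hU0 hV hV0 hU' hU'0 _ ⟨v, hv⟩
  obtain ⟨N, hN⟩ := doubling_eventually_surjOn hU' hU'0
  obtain ⟨n, hn, y, hy, hyV⟩ := hg.exists_ge_iterate (N + 1) hU hU0 hV hV0
  obtain ⟨z, hz, hzv⟩ := hN n (by omega) v
  exact ⟨r + n, by omega, ⟨y, hy, by rwa [evol_delay]⟩, z, hz, by rwa [evol_delay, hzv]⟩

/-- Mild mixing passes to the limit of a collectively convergent sequence of surjections. -/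
theorem IsMildlyMixingPerfect.of_convergesCollectively {X : Type u} [MetricSpace X]
    [CompactSpace X] {F : ℕ → C(X, X)} {f : C(X, X)} (hF : IsMildlyMixingPerfect.{u, v} F)
    (hs : IsSurjective F) (hc : ConvergesCollectively F f) : IsMildlyMixingAut.{u, w} f := by
  intro Y _ _ g hg
  rw [isTransitive_prod_iff]
  rintro U V U' V' hU hU0 hV ⟨v, hv⟩ hU' hU'0 hV' hV'0
  obtain ⟨ε, hε, hball⟩ := Metric.isOpen_iff.1 hV v hv
  obtain ⟨r, hr⟩ := hc (ε / 2) (half_pos hε)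
  have : PerfectSpace (Y × UnitAddCircle) := perfectSpace_prod_right
  have : PerfectSpace (X × Y × UnitAddCircle) := perfectSpace_prod_right
  have hT := IsMildlyMixingPerfect.lift.{u, v, w} hF (Y × UnitAddCircle) _
    (isTransitive_delay_prod_doubling hg r)
  have hsurj := hs.evol 0 r
  obtain ⟨n, hn, ⟨x, y, z⟩, ⟨hx, hy, -⟩, hxV⟩ := hT.exists_gt_of_perfectSpace r
    (U := (evol F 0 r ⁻¹' U) ×ˢ (U' ×ˢ Set.univ)) (V := Metric.ball v (ε / 2) ×ˢ (V' ×ˢ Set.univ))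
    ((hU.preimage (evol F 0 r).continuous).prod (hU'.prod isOpen_univ))
    ((hU0.preimage hsurj).prod (hU'0.prod Set.univ_nonempty))
    (Metric.isOpen_ball.prod (hV'.prod isOpen_univ))
    (Set.Nonempty.prod ⟨v, Metric.mem_ball_self (half_pos hε)⟩ (hV'0.prod Set.univ_nonempty))
  -- After time `r` the first factor starts in `U` and the second still in `U'`; `k` counts the
  -- steps from there.
  obtain ⟨k, rfl⟩ : ∃ k, n = r + k := ⟨n - r, by omega⟩
  have hk : 1 ≤ k := by omega
  rw [evol_prod, evol_prod, evol_add, evol_delay, zero_add] at hxV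
  refine ⟨k, hk, ⟨evol F 0 r x, hx, hball ?_⟩, y, hy, ?_⟩
  · calc dist (evol (const f) 0 k (evol F 0 r x)) v
        ≤ dist (evol F r k (evol F 0 r x)) (evol (const f) 0 k (evol F 0 r x)) +
          dist (evol F r k (evol F 0 r x)) v := dist_triangle_left _ _ _
      _ < ε / 2 + ε / 2 :=
        add_lt_add ((ContinuousMap.dist_apply_le_dist _).trans_lt (hr r le_rfl k hk)) hxV.1
      _ = ε := add_halves ε
  · rw [evol_const_apply]
    exact hxV.2.1

/-! ### Constant sequences and failure of the converse -/

theorem convergesUniformly_const {X : Type u} [MetricSpace X] (f : C(X, X)) :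
    ConvergesUniformly (const f) f := by
  intro s hs
  exact Eventually.of_forall fun n x => refl_mem_uniformity hs

theorem convergesCollectively_const {X : Type u} [MetricSpace X] [CompactSpace X] (f : C(X, X)) :
    ConvergesCollectively (const f) f := by
  intro ε hε
  refine ⟨0, fun r _ k _ => ?_⟩
  have : evol (const f) r k = evol (const f) 0 k := by
    ext x
    simp only [evol_const_apply]
  rwa [this, dist_self]

theorem IsMildlyMixingAut.isTransitive {X : Type u} [TopologicalSpace X] {f : C(X, X)}
    (hf : IsMildlyMixingAut.{u, v} f) : IsTransitive (const f) := by
  have h := hf PUnit (ContinuousMap.id _) (isTransitive_iff.2 fun U V _ hU _ hV => by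
    obtain ⟨u, hu⟩ := hU
    obtain ⟨v, hv⟩ := hV
    exact ⟨1, le_rfl, u, hu, hv⟩)
  rw [isTransitive_prod_iff] at h
  rw [isTransitive_iff]
  intro U V hU hU0 hV hV0
  obtain ⟨n, hn, hx, -⟩ := h U V Set.univ Set.univ hU hU0 hV hV0 isOpen_univ
    Set.univ_nonempty isOpen_univ Set.univ_nonempty
  exact ⟨n, hn, hx⟩

theorem IsTransitive.surjective {X : Type u} [TopologicalSpace X] [T2Space X] [CompactSpace X]
    {f : C(X, X)} (hf : IsTransitive (const f)) : Function.Surjective f := by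
  intro x
  by_contra hx
  have hcl : IsClosed (Set.range f) := (isCompact_range f.continuous).isClosed
  obtain ⟨n, hn, y, -, hy⟩ := isTransitive_iff.1 hf Set.univ (Set.range f)ᶜ isOpen_univ ⟨x, trivial⟩
    hcl.isOpen_compl ⟨x, hx⟩
  obtain ⟨k, rfl⟩ : ∃ k, n = k + 1 := ⟨n - 1, by omega⟩
  exact hy ⟨_, rfl⟩

/-- The translations by the increments of a sequence `c` of group elements. -/
def translations {A : Type u} [AddCommGroup A] [TopologicalSpace A] [IsTopologicalAddGroup A]
    (c : ℕ → A) (n : ℕ) : C(A, A) :=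
  ⟨fun y => (c (n + 1) - c n) + y, by fun_prop⟩

theorem evol_translations {A : Type u} [AddCommGroup A] [TopologicalSpace A]
    [IsTopologicalAddGroup A] {c : ℕ → A} (hc : c 0 = 0) (n : ℕ) (y : A) :
    evol (translations c) 0 n y = c n + y := by
  induction n with
  | zero => rw [hc, zero_add]; rfl
  | succ n ih =>
    change (c (0 + n + 1) - c (0 + n)) + evol (translations c) 0 n y = _
    rw [ih, zero_add]
    abel

/-- A sequence vanishing at `0` and off an infinite set, but with dense values. -/
theorem exists_seq_dense_of_infinite {A : Type u} [Zero A] [TopologicalSpace A]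
    [TopologicalSpace.SeparableSpace A] {S : Set ℕ} (hS : S.Infinite) :
    ∃ c : ℕ → A, c 0 = 0 ∧ (∀ n ∉ S, c n = 0) ∧
      ∀ V : Set A, IsOpen V → V.Nonempty → ∃ n, 1 ≤ n ∧ c n ∈ V := by
  classical
  -- Dropping `0` allows `c 0 = 0` and puts the dense values at times `n ≥ 1`.
  have hS' : (S \ {0}).Infinite := hS.sdiff (Set.finite_singleton 0)
  have : Infinite ↥(S \ {0}) := hS'.to_subtype
  obtain ⟨_⟩ := nonempty_denumerable ↥(S \ {0})
  let e := Denumerable.eqv ↥(S \ {0})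
  refine ⟨fun n => if h : n ∈ S \ {0} then TopologicalSpace.denseSeq A (e ⟨n, h⟩) else 0,
    dif_neg (by simp), fun n hn => dif_neg fun h => hn h.1, fun V hV hV0 => ?_⟩
  obtain ⟨k, hk⟩ := (TopologicalSpace.denseRange_denseSeq A).exists_mem_open hV hV0
  obtain ⟨⟨n, hn⟩, rfl⟩ := e.surjective k
  refine ⟨n, Nat.one_le_iff_ne_zero.2 hn.2, ?_⟩
  simpa only [dif_pos hn] using hk

/-- An autonomous system that is not mixing is not mildly mixing as a non-autonomous system. -/
theorem not_isMildlyMixingPerfect_const {X : Type u} [TopologicalSpace X] {f : C(X, X)}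
    (hf : ¬ IsMixing (const f)) : ¬ IsMildlyMixingPerfect.{u, w} (const f) := by
  intro hm
  have hm0 := IsMildlyMixingPerfect.lift.{u, w, 0} hm
  simp only [IsMixing, Set.image_inter_nonempty_iff] at hf
  push Not at hf
  obtain ⟨U, V, hU, hU0, hV, hV0, h⟩ := hf
  let S : Set ℕ := {n | U ∩ evol (const f) 0 n ⁻¹' V = ∅}
  have hS : S.Infinite := by
    refine Set.infinite_of_not_bddAbove ?_
    rintro ⟨N, hN⟩
    obtain ⟨n, hn, hnS⟩ := h (N + 1) (by omega)
    have := hN hnS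
    omega
  obtain ⟨c, hc0, hcS, hc⟩ := exists_seq_dense_of_infinite (A := UnitAddCircle) hS
  have htr : IsTransitive (translations c) := by
    rw [isTransitive_iff]
    rintro U' V' - ⟨u, hu⟩ hV' ⟨v, hv⟩
    obtain ⟨n, hn, hcn⟩ := hc ((· + u) ⁻¹' V') (hV'.preimage (by fun_prop))
      ⟨v - u, by simpa using hv⟩
    exact ⟨n, hn, u, hu, by rwa [evol_translations hc0]⟩
  have hT := hm0 UnitAddCircle _ htr
  obtain ⟨a, b, hab⟩ := exists_pair_ne UnitAddCircle
  obtain ⟨A, B, hA, hB, haA, hbB, hd⟩ := t2_separation hab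
  rw [isTransitive_prod_iff] at hT
  obtain ⟨n, -, ⟨x, hx, hxV⟩, y, hy, hyB⟩ :=
    hT U V A B hU hU0 hV hV0 hA ⟨a, haA⟩ hB ⟨b, hbB⟩
  -- When `U` meets `V`, the translation evolution is the identity and cannot carry `A` into the
  -- disjoint `B`.
  have hn : n ∉ S := fun hn => Set.notMem_empty x (hn ▸ ⟨hx, hxV⟩)
  rw [evol_translations hc0, hcS n hn, zero_add] at hyB
  exact Set.disjoint_left.1 hd hy hyB

theorem not_isMildlyMixing_const {X : Type u} [TopologicalSpace X] {f : C(X, X)}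
    (hf : ¬ IsMixing (const f)) : ¬ IsMildlyMixing.{u, w} (const f) :=
  fun h => not_isMildlyMixingPerfect_const hf h.perfect

/-! ### The spacing shift: mildly mixing but not mixing -/

/-- The spacing shift: bi-infinite binary sequences in which the distance of two ones is never a
power of two. -/
def spacingShift : Set (ℤ → Bool) :=
  {x | ∀ i j, x i = true → x j = true → ∀ k : ℕ, j - i ≠ 2 ^ k}

theorem isClosed_spacingShift : IsClosed spacingShift := by
  simp only [spacingShift, Set.ofPred_forall]
  refine isClosed_iInter fun i => isClosed_iInter fun j => ?_
  have h : ∀ i : ℤ, IsClopen {x : ℤ → Bool | x i = true} := fun i =>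
    (isClopen_discrete ({true} : Set Bool)).preimage (continuous_apply i)
  exact isClosed_imp (h i).isOpen <| isClosed_imp (h j).isOpen isClosed_const

/-- The phase space of the spacing shift, in an arbitrary universe. -/
abbrev SpacingSpace : Type u := ULift.{u} spacingShift

instance : CompactSpace SpacingSpace.{u} :=
  have : CompactSpace spacingShift := isCompact_iff_compactSpace.1 isClosed_spacingShift.isCompact
  Homeomorph.ulift.symm.compactSpace

instance : TopologicalSpace.MetrizableSpace SpacingSpace.{u} :=
  Homeomorph.ulift.isEmbedding.metrizableSpace

/-- The translation by `m` on the spacing shift. -/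
def spacingTranslate (m : ℤ) : C(SpacingSpace.{u}, SpacingSpace.{u}) where
  toFun x := ⟨fun i => x.down.1 (i + m), fun i j hi hj k h =>
    x.down.2 _ _ hi hj k (by rw [← h]; ring)⟩
  continuous_toFun := by
    refine continuous_uliftUp.comp (Continuous.subtype_mk (continuous_pi fun i => ?_) _)
    exact (continuous_apply _).comp (continuous_subtype_val.comp continuous_uliftDown)

theorem spacingTranslate_iterate (n : ℕ) (x : SpacingSpace.{u}) (i : ℤ) :
    ((spacingTranslate 1)^[n] x).down.1 i = x.down.1 (i + n) := by
  induction n generalizing i with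
  | zero => simp
  | succ n ih =>
    rw [Function.iterate_succ_apply']
    change ((spacingTranslate 1)^[n] x).down.1 (i + 1) = _
    rw [ih, Nat.cast_succ, add_assoc, add_comm (1 : ℤ)]

/-- The shift map of the spacing shift, as a homeomorphism. -/
def spacingHomeomorph : SpacingSpace.{u} ≃ₜ SpacingSpace.{u} where
  toFun := spacingTranslate 1
  invFun := spacingTranslate (-1)
  left_inv x := by
    apply ULift.ext
    apply Subtype.ext
    funext i
    change x.down.1 (i + -1 + 1) = _
    rw [neg_add_cancel_right]
  right_inv x := by
    apply ULift.ext
    apply Subtype.ext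
    funext i
    change x.down.1 (i + 1 + -1) = _
    rw [add_neg_cancel_right]
  continuous_toFun := (spacingTranslate 1).continuous
  continuous_invFun := (spacingTranslate (-1)).continuous

/-- A neighbourhood of a point contains all points that agree with it on a long window. -/
theorem exists_window {U : Set SpacingSpace.{u}} (hU : IsOpen U) {x : SpacingSpace.{u}}
    (hx : x ∈ U) : ∃ L : ℕ, ∀ y : SpacingSpace.{u},
      (∀ i : ℤ, |i| ≤ L → y.down.1 i = x.down.1 i) → y ∈ U := by
  obtain ⟨W, hW, hWU⟩ := isOpen_induced_iff.1 (hU.preimage continuous_uliftUp)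
  have hiff : ∀ y : SpacingSpace.{u}, y.down.1 ∈ W ↔ y ∈ U := fun y =>
    Set.ext_iff.1 hWU y.down
  obtain ⟨I, u, hu, hIW⟩ := isOpen_pi_iff.1 hW x.down.1 ((hiff x).2 hx)
  refine ⟨I.sup Int.natAbs, fun y hy => (hiff y).1 (hIW fun i hi => ?_)⟩
  rw [hy i]
  · exact (hu i hi).2
  · have : i.natAbs ≤ I.sup Int.natAbs := Finset.le_sup (f := Int.natAbs) hi
    rw [Int.abs_eq_natAbs]
    exact_mod_cast this

/-- Two windows can be seen at distance `n` if `n` is far away from all powers of two. -/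
theorem exists_spacing_glue (x y : SpacingSpace.{u}) {L n : ℕ} (hn : 2 * L < n)
    (hpow : ∀ k : ℕ, 2 * (L : ℤ) < |(n : ℤ) - 2 ^ k|) :
    ∃ z : SpacingSpace.{u}, (∀ i : ℤ, |i| ≤ L → z.down.1 i = x.down.1 i) ∧
      ∀ i : ℤ, |i| ≤ L → z.down.1 (i + n) = y.down.1 i := by
  let z : ℤ → Bool := fun i =>
    if |i| ≤ L then x.down.1 i else if |i - n| ≤ L then y.down.1 (i - n) else false
  have hz : z ∈ spacingShift := by
    intro i j hi hj k hk
    have hp : (0 : ℤ) < 2 ^ k := by positivity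
    have hpk := hpow k
    simp only [z] at hi hj
    split_ifs at hi hj with h1 h2 h3 h4 h5 h6
    -- Ones in the same window inherit the spacing from `x` or `y`. Across windows, `j - i` is
    -- within `2 * L` of `n`, or negative.
    · exact x.down.2 i j hi hj k hk
    · rw [← hk] at hpk
      rw [abs_le] at *
      rw [lt_abs] at hpk
      omega
    · rw [abs_le] at *
      omega
    · exact y.down.2 _ _ hi hj k (by rw [← hk]; ring)
  refine ⟨⟨⟨z, hz⟩⟩, fun i hi => if_pos hi, fun i hi => ?_⟩
  change z (i + n) = _
  have h1 : ¬ |i + (n : ℤ)| ≤ L := by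
    rw [abs_le] at *
    omega
  simp only [z, if_neg h1, add_sub_cancel_right, if_pos hi]

/-- Far out, of two integers at a large fixed distance one is far away from all powers of two. -/
theorem far_from_pow_two {M p n : ℕ} (hp : 2 * M < p) (hn : p + 4 * M < n) :
    (∀ k : ℕ, (M : ℤ) < |(n : ℤ) - 2 ^ k|) ∨
      ∀ k : ℕ, (M : ℤ) < |((n + p : ℕ) : ℤ) - 2 ^ k| := by
  by_contra! h
  obtain ⟨⟨a, ha⟩, b, hb⟩ := h
  push_cast at hb
  rw [abs_le] at ha hb
  -- The gap `2 ^ b - 2 ^ a` lies within `2 * M` of `p`, hence is positive; but distinct powers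
  -- differ by at least `2 ^ a ≥ n - M > p + 3 * M`.
  have hlt : (2 : ℤ) ^ a < 2 ^ b := by omega
  have hab : a < b := (pow_lt_pow_iff_right₀ (by norm_num)).1 hlt
  have : (2 : ℤ) ^ (a + 1) ≤ 2 ^ b := pow_le_pow_right₀ (by norm_num) hab
  rw [pow_succ] at this
  omega

theorem isMildlyMixingAut_spacing : IsMildlyMixingAut.{u, v} (spacingTranslate.{u} 1) := by
  intro Y _ _ g hg
  rw [isTransitive_prod_iff]
  rintro U V U' V' hU ⟨x, hx⟩ hV ⟨y, hy⟩ hU' hU'0 hV' hV'0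
  obtain ⟨L₁, hL₁⟩ := exists_window hU hx
  obtain ⟨L₂, hL₂⟩ := exists_window hV hy
  let L := max L₁ L₂
  have hit : ∀ n : ℕ, 2 * L < n → (∀ k : ℕ, ((2 * L : ℕ) : ℤ) < |(n : ℤ) - 2 ^ k|) →
      ∃ z ∈ U, evol (const (spacingTranslate.{u} 1)) 0 n z ∈ V := by
    intro n hn hpow
    obtain ⟨z, hzx, hzy⟩ := exists_spacing_glue x y hn (by exact_mod_cast hpow)
    refine ⟨z, hL₁ z fun i hi => hzx i (hi.trans (by exact_mod_cast le_max_left _ _)), ?_⟩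
    rw [evol_const_apply]
    refine hL₂ _ fun i hi => ?_
    rw [spacingTranslate_iterate]
    exact hzy i (hi.trans (by exact_mod_cast le_max_right _ _))
  obtain ⟨p, hp, v, hv, hvV⟩ := hg.exists_ge_iterate (4 * L + 1) hV' hV'0 hV' hV'0
  -- Both `n` and `n + p` are hitting times of `g`; one of them avoids the powers of two by more
  -- than `2 * L`.
  obtain ⟨n, hn, w, hw, hwV, hwp⟩ := hg.exists_ge_iterate (p + 8 * L + 1) hU' hU'0
    (hV'.inter (hV'.preimage (g.continuous.iterate p))) ⟨v, hv, hvV⟩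
  rcases far_from_pow_two (M := 2 * L) (p := p) (n := n) (by omega) (by omega) with h | h
  · exact ⟨n, by omega, hit n (by omega) h, w, hw, by rwa [evol_const_apply]⟩
  · refine ⟨n + p, by omega, hit (n + p) (by omega) h, w, hw, ?_⟩
    rw [evol_const_apply, add_comm, Function.iterate_add_apply]
    exact hwp

theorem not_isMixing_spacing : ¬ IsMixing (const (spacingTranslate.{u} 1)) := by
  intro h
  let U : Set SpacingSpace.{u} := {x | x.down.1 0 = true}
  have hc : Continuous fun x : SpacingSpace.{u} => x.down.1 0 :=
    (continuous_apply _).comp (continuous_subtype_val.comp continuous_uliftDown)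
  have hU : IsOpen U := (isOpen_discrete ({true} : Set Bool)).preimage hc
  have hU0 : U.Nonempty := by
    refine ⟨⟨⟨fun i => decide (i = 0), fun i j hi hj k hk => ?_⟩⟩, ?_⟩
    · have : (0 : ℤ) < 2 ^ k := by positivity
      rw [decide_eq_true_eq] at hi hj
      omega
    · exact decide_eq_true (rfl : (0 : ℤ) = 0)
  obtain ⟨N, -, hN⟩ := h U U hU hU0 hU hU0
  -- Time `2 ^ N ≥ N` would require two ones at the forbidden distance `2 ^ N`.
  obtain ⟨_, ⟨x, hx, rfl⟩, hx'⟩ := hN (2 ^ N) Nat.lt_two_pow_self.le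
  rw [evol_const_apply] at hx'
  have h' : x.down.1 (0 + (2 ^ N : ℕ)) = true := (spacingTranslate_iterate _ _ _).symm.trans hx'
  exact x.down.2 0 _ hx h' N (by push_cast; ring)

theorem isFeeblyOpen_spacing : IsFeeblyOpen (const (spacingTranslate.{u} 1)) := by
  intro i U hU hU0
  have : IsOpen (spacingTranslate.{u} 1 '' U) := spacingHomeomorph.isOpenMap U hU
  change (interior (spacingTranslate.{u} 1 '' U)).Nonempty
  rw [this.interior_eq]
  exact hU0.image _

end NDS

theorem mainTheorem8 :
    -- mild mixing passes to the limit map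
    (∀ (X : Type u) [MetricSpace X] [CompactSpace X] (F : ℕ → C(X, X)) (f : C(X, X)),
      NDS.IsFeeblyOpen F → NDS.IsSurjective F →
      NDS.ConvergesUniformly F f → NDS.ConvergesCollectively F f →
        (NDS.IsMildlyMixing.{u, v} F → NDS.IsMildlyMixingAut.{u, w} f) ∧
        (NDS.IsMildlyMixingPerfect.{u, v} F → NDS.IsMildlyMixingAut.{u, w} f)) ∧
    -- every mildly mixing, non-mixing map yields a constant sequence that is not mildly mixing
    (∀ (X : Type u) [MetricSpace X] [CompactSpace X] (f : C(X, X)),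
      NDS.IsMildlyMixingAut.{u, v} f → ¬ NDS.IsMixing (NDS.const f) →
        NDS.IsSurjective (NDS.const f) ∧
        NDS.ConvergesUniformly (NDS.const f) f ∧ NDS.ConvergesCollectively (NDS.const f) f ∧
        ¬ NDS.IsMildlyMixing.{u, w} (NDS.const f) ∧
        ¬ NDS.IsMildlyMixingPerfect.{u, w} (NDS.const f)) ∧
    -- such maps exist, also feebly open ones, so that the converse of the first part fails
    (∃ (X : Type u) (_ : MetricSpace X) (_ : CompactSpace X) (f : C(X, X)),
      NDS.IsMildlyMixingAut.{u, v} f ∧ ¬ NDS.IsMixing (NDS.const f) ∧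
        NDS.IsFeeblyOpen (NDS.const f) ∧ NDS.IsSurjective (NDS.const f) ∧
        NDS.ConvergesUniformly (NDS.const f) f ∧ NDS.ConvergesCollectively (NDS.const f) f ∧
        ¬ NDS.IsMildlyMixing.{u, w} (NDS.const f) ∧
        ¬ NDS.IsMildlyMixingPerfect.{u, w} (NDS.const f)) := by
  have main2 : ∀ (X : Type u) [MetricSpace X] [CompactSpace X] (f : C(X, X)),
      NDS.IsMildlyMixingAut.{u, v} f → ¬ NDS.IsMixing (NDS.const f) →
        NDS.IsSurjective (NDS.const f) ∧
        NDS.ConvergesUniformly (NDS.const f) f ∧ NDS.ConvergesCollectively (NDS.const f) f ∧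
        ¬ NDS.IsMildlyMixing.{u, w} (NDS.const f) ∧
        ¬ NDS.IsMildlyMixingPerfect.{u, w} (NDS.const f) :=
    fun X _ _ f hf hm => ⟨fun _ => hf.isTransitive.surjective, NDS.convergesUniformly_const f,
      NDS.convergesCollectively_const f, NDS.not_isMildlyMixing_const hm,
      NDS.not_isMildlyMixingPerfect_const hm⟩
  refine ⟨fun X _ _ F f _ hs _ hc => ⟨fun h => h.perfect.of_convergesCollectively hs hc,
    fun h => h.of_convergesCollectively hs hc⟩, main2, ?_⟩
  let _ : MetricSpace NDS.SpacingSpace.{u} := TopologicalSpace.metrizableSpaceMetric _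
  exact ⟨NDS.SpacingSpace.{u}, inferInstance, inferInstance, NDS.spacingTranslate 1,
    NDS.isMildlyMixingAut_spacing, NDS.not_isMixing_spacing, NDS.isFeeblyOpen_spacing,
    main2 _ _ NDS.isMildlyMixingAut_spacing NDS.not_isMixing_spacing⟩
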